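/- All graphs are finite, undirected and simple, and their nodes carry colors from a fixed nonempty set $C$; $\mathcal N_1(v)$ is the set of nodes at distance at most $1$ from $v$ (including $v$). An algorithm $F_1$ is \emph{more powerful} than $F_2$ if, for all graphs $G,H$, whenever $F_1$ gives $G$ and $H$ the same final value (color histogram after convergence), so does $F_2$; it is \emph{as powerful as} $F_2$ if each is more powerful than the other, and \emph{strictly more powerful} if it is more powerful and some pair $G,H$ gets equal values from $F_2$ and different values from $F_1$. \emph{$(k,t)$-FWL+.} Given equivariant node sets $ES_1(\mathbf v),\dots,ES_t(\mathbf v)$ for $k$-tuples $\mathbf v$, the initial color $\mathcal C^0(\mathbf v)$ is the isomorphism type of $\mathbf v$ (node colors, equalities and adjacencies), and $$\mathcal C^{l}(\mathbf v)=\mathrm{HASH}\Big(\mathcal C^{l-1}(\mathbf v),\ \{\!\!\{(\mathcal C^{l-1}(\mathbf u)\mid \mathbf u\in Q^F_{\mathbf w}(\mathbf v))\mid \mathbf w\in ES_1(\mathbf v)\times\cdots\times ES_t(\mathbf v)\}\!\!\}_t\Big)$$ with $\mathrm{HASH}$ injective, where $\{\!\!\{\cdot\}\!\!\}_t$ is the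 multiset nested $t$ times (innermost over $w_1$, outermost over $w_t$) and $Q^F_{\mathbf w}(\mathbf v)$ is the family of all tuples obtained from $\mathbf v$ by choosing $m\le\min(k,t)$, an increasing choice of $m$ entries of $\mathbf w$ and an increasing choice of $m$ positions of $\mathbf v$, and replacing the latter by the former. The histogram of $G$ is $\{\!\!\{\mathcal C^\infty(\mathbf v)\mid \mathbf v\in V(G)^k\}\!\!\}$. \emph{SLFWL(2)} colors pairs, starting from their isomorphism types, by $$\chi^{l}(u,v)=\mathrm{HASH}\big(\chi^{l-1}(u,v),\{\!\!\{(\chi^{l-1}(u,w),\chi^{l-1}(w,v))\mid w\in\mathcal N_1(u)\cup\mathcal N_1(v)\}\!\!\}\big),$$ with histogram $\{\!\!\{\chi^\infty(u,v)\mid u,v\in V(G)\}\!\!\}$. \emph{Node-based subgraph GNNs.} A policy turns $G$ into subgraphs $G^u$, $u\in V(G)$, all regarded as graphs on $V(G)$ (removed nodes become isolated): node marking ($G^u=G$, $u$ marked), distance encoding ($G^u=G$, each $v$ labeled by its distance from $u$), node deletion ($G^u=G-u$), $r$-hop ego network, or $r$-hop ego network with $u$ marked. The initial feature $h^0(u,v)$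 is a function of the color of $v$, of whether $v$ belongs to $G^u$, and of the mark or distance label. Then $h^{l+1}(u,v)$ is an arbitrary function of the results of a set of atomic operations chosen among: $h^l(u,v)$, $h^l(v,u)$, $h^l(u,u)$, $h^l(v,v)$, $\{\!\!\{h^l(u,w)\mid w\in V(G)\}\!\!\}$, $\{\!\!\{h^l(w,v)\mid w\in V(G)\}\!\!\}$, $\{\!\!\{h^l(u,w)\mid w\in N_{G^u}(v)\}\!\!\}$, $\{\!\!\{h^l(w,v)\mid w\in N_{G^v}(u)\}\!\!\}$ (so sum, mean or max aggregation is included). After finitely many layers a readout is applied to the nested multiset of all final $h(u,v)$, pooling first over $v$ and then over $u$, or first over $u$ and then over $v$. An architecture consists of a policy, a set of atomic operations and a pooling order; it gives $G$ and $H$ the same value if every GNN of that architecture (any depth, feature spaces, initial encoding, update and readout functions) does. \textbf{Proposition.} Consider the $(2,1)$-FWL+ instance with $ES(\mathbf v)=\mathcal N_1(v_1)\cup\mathcal N_1(v_2)$. 1. It coincides with SLFWL(2): for all graphs $G,H$, all pairs $\mathbf v\in V(G)^2$, $\mathbf v'\in V(H)^2$ and every iteration $l$, $\mathcal C^l(\mathbf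 v)=\mathcal C^l(\mathbf v')$ if and only if $\chi^l(v_1,v_2)=\chi^l(v_1',v_2')$. In particular it is as powerful as SLFWL(2). 2. It is strictly more powerful than every node-based subgraph GNN architecture: it is more powerful, and for each architecture there are graphs $G,H$ that it distinguishes and that no GNN of the architecture distinguishes. -/

import Mathlib

/-- A finite, undirected, simple graph whose nodes carry colors from `C`. -/
structure ColoredGraph (C : Type) where
  V : Type
  [fintype : Fintype V]
  graph : SimpleGraph V
  label : V → C

attribute [instance] ColoredGraph.fintype

namespace ColoredGraph

/-- Isomorphisms of colored graphs (relabelings of the node set): color-preserving graph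
isomorphisms. -/
structure Iso {C : Type} (G H : ColoredGraph C) where
  toIso : G.graph ≃g H.graph
  label_eq : ∀ v, H.label (toIso v) = G.label v

open scoped Classical in
/-- `𝒩_r(v)`: the nodes within `r` hops of `v` (so `v` itself belongs to it). -/
noncomputable def ball {C : Type} (G : ColoredGraph C) (r : ℕ) (v : G.V) : Finset G.V :=
  Finset.univ.filter fun w => G.graph.edist v w ≤ r

end ColoredGraph

/-! ### Comparing algorithms on pairs of graphs -/

/-- An algorithm that maps graphs to a final value (such as a color histogram), recorded through
the relation "the final values of `G` and `H` are equal". -/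
abbrev GraphTest (C : Type) := ColoredGraph C → ColoredGraph C → Prop

/-- `F₁` is more powerful than `F₂`: whenever `F₁` gives `G` and `H` the same value,
so does `F₂`. -/
def MorePowerful {C : Type} (F₁ F₂ : GraphTest C) : Prop :=
  ∀ G H : ColoredGraph C, F₁ G H → F₂ G H

/-- `F₁` is as powerful as `F₂`. -/
def AsPowerful {C : Type} (F₁ F₂ : GraphTest C) : Prop :=
  MorePowerful F₁ F₂ ∧ MorePowerful F₂ F₁

/-- `F₁` is strictly more powerful than `F₂`. -/
def StrictlyMorePowerful {C : Type} (F₁ F₂ : GraphTest C) : Prop :=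
  MorePowerful F₁ F₂ ∧ ∃ G H : ColoredGraph C, ¬ F₁ G H ∧ F₂ G H

/-! ### `(k, t)`-FWL+ -/

/-- Multisets of multisets of ... (`t` levels) of elements of `α`. -/
def HMultiset (α : Type) : ℕ → Type
  | 0 => α
  | t + 1 => Multiset (HMultiset α t)

/-- The hierarchical multiset `{{ f w | w ∈ S₁ × ⋯ × S_t }}_t`: the innermost level runs over the
first entry of `w`, the outermost level over the last one. -/
def hierMultiset {α V : Type} :
    (t : ℕ) → (Fin t → Finset V) → ((Fin t → V) → α) → HMultiset α t
  | 0, _, f => f Fin.elim0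
  | t + 1, S, f =>
      (S (Fin.last t)).val.map fun x =>
        hierMultiset t (fun i => S i.castSucc) fun w => f (Fin.snoc w x)

/-- The positions of a neighborhood tuple: a number `m ≤ min k t`, a selection of `m` of the `t`
indices and a selection of `m` of the `k` indices, both increasing. -/
abbrev NbrIndex (k t : ℕ) : Type :=
  Σ m : Fin (min k t + 1), (Fin m ↪o Fin t) × (Fin m ↪o Fin k)

/-- The neighborhood tuple `Q^F_w(v)`, as a family over its positions: at position
`(m, w', i')` the entries of `v` with indices `i'` are replaced by the selected entries of `w`. -/
noncomputable def nbrTuple {V : Type} {k t : ℕ} (v : Fin k → V) (w : Fin t → V) :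
    NbrIndex k t → (Fin k → V) :=
  fun q => Function.extend q.2.2 (w ∘ q.2.1) v

/-- Isomorphism types of `k`-tuples: node colors, equality pattern, adjacency pattern. -/
abbrev IsoType (C : Type) (k : ℕ) : Type :=
  (Fin k → C) × (Fin k → Fin k → Prop) × (Fin k → Fin k → Prop)

def isoType {C : Type} (G : ColoredGraph C) {k : ℕ} (v : Fin k → G.V) : IsoType C k :=
  (fun i => G.label (v i), fun i j => v i = v j, fun i j => G.graph.Adj (v i) (v j))

/-- An equivariant set of nodes attached to each `k`-tuple. -/
structure EquivariantSet (C : Type) (k : ℕ) where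
  set : (G : ColoredGraph C) → (Fin k → G.V) → Finset G.V
  equivariant : ∀ (G H : ColoredGraph C) (g : G.Iso H) (v : Fin k → G.V),
    ∀ w ∈ set G v, g.toIso w ∈ set H (g.toIso ∘ v)

/-- The colors available at each iteration. The injective function `HASH` is taken to be the
pairing of its two arguments, so that a color is literally the information that was hashed. -/
def KTColor (C : Type) (k t : ℕ) : ℕ → Type
  | 0 => IsoType C k
  | l + 1 => KTColor C k t l × HMultiset (NbrIndex k t → KTColor C k t l) t

/-- The color of the tuple `v` at iteration `l` of `(k, t)`-FWL+ with
`ES^t(v) = ES₁(v) × ⋯ × ES_t(v)`. -/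
noncomputable def ktColor {C : Type} {k t : ℕ} (ES : Fin t → EquivariantSet C k)
    (G : ColoredGraph C) : (l : ℕ) → (Fin k → G.V) → KTColor C k t l
  | 0, v => isoType G v
  | l + 1, v =>
      (ktColor ES G l v,
        hierMultiset t (fun i => (ES i).set G v)
          fun w => fun q => ktColor ES G l (nbrTuple v w q))

open scoped Classical in
/-- The color histogram of a graph at iteration `l`. -/
noncomputable def ktHistogram {C : Type} {k t : ℕ} (ES : Fin t → EquivariantSet C k)
    (G : ColoredGraph C) (l : ℕ) : Multiset (KTColor C k t l) :=
  (Finset.univ : Finset (Fin k → G.V)).val.map (ktColor ES G l)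

/-- `(k, t)`-FWL+ as a test: after convergence, i.e. from some iteration on, the color histograms
agree. -/
def ktFWLPlus {C : Type} {k t : ℕ} (ES : Fin t → EquivariantSet C k) : GraphTest C :=
  fun G H => ∀ᶠ l in Filter.atTop, ktHistogram ES G l = ktHistogram ES H l

open scoped Classical in
/-- `ES(v) = 𝒩₁(v₁) ∪ 𝒩₁(v₂)`. -/
noncomputable def unionES (C : Type) : EquivariantSet C 2 where
  set G v := G.ball 1 (v 0) ∪ G.ball 1 (v 1)
  equivariant := by
    intro G H g v w hw
    have key : ∀ a b : G.V, G.graph.edist a b ≤ 1 →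
        H.graph.edist (g.toIso a) (g.toIso b) ≤ 1 := by
      intro a b h
      rw [SimpleGraph.edist_le_one_iff_adj_or_eq] at h ⊢
      rcases h with h | h
      · exact Or.inl (g.toIso.map_adj_iff.2 h)
      · exact Or.inr (congrArg g.toIso h)
    simp only [ColoredGraph.ball, Finset.mem_union, Finset.mem_filter, Finset.mem_univ,
      true_and, Nat.cast_one, Function.comp_apply] at hw ⊢
    exact hw.imp (key _ _) (key _ _)

/-- The equivariant sets of the `(2, 1)`-FWL+ instance with `ES(v) = 𝒩₁(v₁) ∪ 𝒩₁(v₂)`. -/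
noncomputable def instES (C : Type) : Fin 1 → EquivariantSet C 2 := fun _ => unionES C

/-! ### SLFWL(2), the symmetric localized 2-FWL test -/

/-- The colors available at each iteration (again with pairing in the role of the injective
hash function). The initial colors are the isomorphism types of pairs of nodes. -/
def SLColor (C : Type) : ℕ → Type
  | 0 => C × C × Prop × Prop
  | l + 1 => SLColor C l × Multiset (SLColor C l × SLColor C l)

open scoped Classical in
/-- The color `χ^l(u, v)`, with update
`χ^{l+1}(u, v) = HASH (χ^l(u, v), {{ (χ^l(u, w), χ^l(w, v)) | w ∈ 𝒩₁(u) ∪ 𝒩₁(v) }})`. -/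
noncomputable def slColor {C : Type} (G : ColoredGraph C) : (l : ℕ) → G.V → G.V → SLColor C l
  | 0, u, v => (G.label u, G.label v, u = v, G.graph.Adj u v)
  | l + 1, u, v =>
      (slColor G l u v,
        (G.ball 1 u ∪ G.ball 1 v).val.map fun w => (slColor G l u w, slColor G l w v))

noncomputable def slHistogram {C : Type} (G : ColoredGraph C) (l : ℕ) :
    Multiset (SLColor C l) :=
  (Finset.univ : Finset (G.V × G.V)).val.map fun p => slColor G l p.1 p.2

/-- SLFWL(2) as a test. -/
def slfwl2 (C : Type) : GraphTest C :=
  fun G H => ∀ᶠ l in Filter.atTop, slHistogram G l = slHistogram H l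

/-! ### Node-based subgraph GNNs

A graph `G` is turned into the collection of subgraphs `G^u`, one for each node `u`, and
representations `h(u, v)` of the nodes `v` of all the `G^u` are updated by message passing. All
the `G^u` are regarded as graphs on the node set of `G`; a removed node becomes isolated and its
removal is visible in its initial feature. -/

/-- Node-based subgraph selection policies. -/
inductive NodePolicy
  /-- `G^u = G` with the node `u` marked -/
  | nodeMarking
  /-- `G^u = G` with each node labeled by its distance from `u` -/
  | distanceEncoding
  /-- `G^u = G` without the node `u` -/
  | nodeDeletion
  /-- `G^u` is the subgraph induced by the nodes within `r` hops of `u` -/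
  | egoNetwork (r : ℕ)
  /-- the same, with the node `u` marked -/
  | egoNetworkMarking (r : ℕ)

namespace NodePolicy

/-- `v` is a node of `G^u`. -/
def Mem {C : Type} (G : ColoredGraph C) (u v : G.V) : NodePolicy → Prop
  | nodeMarking => True
  | distanceEncoding => True
  | nodeDeletion => v ≠ u
  | egoNetwork r => v ∈ G.ball r u
  | egoNetworkMarking r => v ∈ G.ball r u

open scoped Classical in
/-- The extra label of the node `v` in `G^u`. -/
noncomputable def mark {C : Type} (G : ColoredGraph C) (u v : G.V) : NodePolicy → ℕ∞
  | nodeMarking => if v = u then 1 else 0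
  | distanceEncoding => G.graph.edist u v
  | nodeDeletion => 0
  | egoNetwork _ => 0
  | egoNetworkMarking _ => if v = u then 1 else 0

open scoped Classical in
/-- The neighbors of `v` in `G^u`. -/
noncomputable def nbrs {C : Type} (π : NodePolicy) (G : ColoredGraph C) (u v : G.V) :
    Finset G.V :=
  Finset.univ.filter fun w => G.graph.Adj v w ∧ π.Mem G u v ∧ π.Mem G u w

end NodePolicy

/-- The atomic operations from which the update of `h(u, v)` may be built. -/
inductive AtomicOp
  /-- `h(u, v)` -/
  | pointUV
  /-- `h(v, u)` -/
  | pointVU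
  /-- `h(u, u)` -/
  | pointUU
  /-- `h(v, v)` -/
  | pointVV
  /-- aggregation of `h(u, w)` over all nodes `w` -/
  | globalU
  /-- aggregation of `h(w, v)` over all nodes `w` -/
  | globalV
  /-- aggregation of `h(u, w)` over the neighbors `w` of `v` in `G^u` -/
  | localU
  /-- aggregation of `h(w, v)` over the neighbors `w` of `u` in `G^v` -/
  | localV

namespace AtomicOp

/-- The kind of information that an operation returns. An aggregation returns the multiset of the
representations; sums, means, maxima of (transformed) features are functions of it. -/
def Val (F : Type) : AtomicOp → Type
  | pointUV => F
  | pointVU => F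
  | pointUU => F
  | pointVV => F
  | globalU => Multiset F
  | globalV => Multiset F
  | localU => Multiset F
  | localV => Multiset F

noncomputable def eval {C F : Type} (π : NodePolicy) (G : ColoredGraph C)
    (h : G.V → G.V → F) (u v : G.V) : (o : AtomicOp) → o.Val F
  | pointUV => h u v
  | pointVU => h v u
  | pointUU => h u u
  | pointVV => h v v
  | globalU => (Finset.univ : Finset G.V).val.map fun w => h u w
  | globalV => (Finset.univ : Finset G.V).val.map fun w => h w v
  | localU => (π.nbrs G u v).val.map fun w => h u w
  | localV => (π.nbrs G v u).val.map fun w => h w v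

end AtomicOp

/-- The two orders of the final pooling: `vertexSubgraph` pools the nodes `v` of each `G^u` first
and then pools over `u`; `subgraphVertex` pools over the subgraphs first. -/
inductive PoolOrder
  | vertexSubgraph
  | subgraphVertex

/-- A node-based subgraph GNN architecture: a policy, the atomic operations used by its layers and
a pooling order. -/
structure SubgraphGNNArch where
  policy : NodePolicy
  ops : Set AtomicOp
  pool : PoolOrder

/-- A subgraph GNN of the architecture `a`, with arbitrary depth, feature spaces, initial
encoding, update functions and readout functions. -/
structure SubgraphGNN (C : Type) (a : SubgraphGNNArch) where
  depth : ℕ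
  Feat : ℕ → Type
  /-- computes the initial feature of `v` in `G^u` from the color of `v`, the presence of `v` in
  `G^u` and the extra label of `v` -/
  init : C → Prop → ℕ∞ → Feat 0
  update : (l : ℕ) → ((o : a.ops) → o.1.Val (Feat l)) → Feat (l + 1)
  Inner : Type
  Out : Type
  innerReadout : Multiset (Feat depth) → Inner
  readout : Multiset Inner → Out

namespace SubgraphGNN

/-- The representation `h^l(u, v)`. -/
noncomputable def feature {C : Type} {a : SubgraphGNNArch} (M : SubgraphGNN C a)
    (G : ColoredGraph C) : (l : ℕ) → G.V → G.V → M.Feat l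
  | 0, u, v => M.init (G.label v) (a.policy.Mem G u v) (a.policy.mark G u v)
  | l + 1, u, v => M.update l fun o => o.1.eval a.policy G (M.feature G l) u v

/-- The representation of the whole graph. -/
noncomputable def output {C : Type} {a : SubgraphGNNArch} (M : SubgraphGNN C a)
    (G : ColoredGraph C) : M.Out :=
  match a.pool with
  | .vertexSubgraph =>
      M.readout <| (Finset.univ : Finset G.V).val.map fun u =>
        M.innerReadout <| (Finset.univ : Finset G.V).val.map fun v => M.feature G M.depth u v
  | .subgraphVertex =>
      M.readout <| (Finset.univ : Finset G.V).val.map fun v =>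
        M.innerReadout <| (Finset.univ : Finset G.V).val.map fun u => M.feature G M.depth u v

end SubgraphGNN

/-- The architecture `a` as a test: no GNN of this architecture separates the two graphs. -/
def SubgraphGNNArch.test (C : Type) (a : SubgraphGNNArch) : GraphTest C :=
  fun G H => ∀ M : SubgraphGNN C a, M.output G = M.output H

/-! For `(2, 1)`-FWL+ a neighborhood tuple is the pair itself (`m = 0`) or the pair with one entry
replaced by `w`. Since the pair's own color is hashed anyway, the family over all positions carries
the same information as the two colors used by SLFWL(2). Induction on the iteration gives
`ktColor_eq_iff_slColor_eq`, and from here on only SLFWL(2) is needed.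

A subgraph GNN cannot separate two graphs whose pairs carry colorings satisfying `SubgraphStable`:
such colors determine distances, hence marks and membership in `G^u`, and every atomic operation.
The stable SLFWL(2) colors form such colorings when the histograms agree
(`subgraphStable_stableColor`). The difficulty is the global aggregation over all `w`, because
SLFWL(2) looks only at nodes near `u` and `v`. Inside the component of `u`, counting edges between
color classes twice fixes the ratios of class sizes along walks, starting from the class `{u}`
(`card_colorClass_eq`). Outside it, the color of `(u, w)` depends only on the colors of `(u, u)` and
`(w, w)` (`slColor_eq_of_not_reachable`), and the diagonal histogram supplies the remaining nodes.

For strictness, one pair of Fürer graphs serves all architectures. An explicit coloring of their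
pairs with 30 colors is `SubgraphStable`, by finite computation. SLFWL(2) sees the colors of `(u,
w)` and `(w, v)` jointly for one `w`, so it detects a triangle of edges with at least three common
neighbors each. The untwisted graph has one, and parity excludes it in the twisted graph. -/

/-! ### Transfer of equalities between multisets of colors -/

section MultisetTransfer

variable {α β γ δ : Type*} {s : Multiset α} {t : Multiset β}

theorem Multiset.map_eq_map_of_forall_mem {f : α → γ} {g : β → γ} {f' : α → δ} {g' : β → δ}
    (h : s.map f = t.map g) (H : ∀ a ∈ s, ∀ b ∈ t, f a = g b → f' a = g' b) :
    s.map f' = t.map g' := by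
  rw [← Multiset.rel_eq, Multiset.rel_map] at h ⊢
  exact h.mono fun a ha b hb hab => H a ha b hb hab

theorem Multiset.map_filter_eq_map_filter {f : α → γ} {g : β → γ} {p : α → Prop} {q : β → Prop}
    [DecidablePred p] [DecidablePred q] (h : s.map f = t.map g)
    (H : ∀ a b, f a = g b → (p a ↔ q b)) :
    (s.filter p).map f = (t.filter q).map g := by
  rw [← Multiset.rel_eq, Multiset.rel_map] at h ⊢
  induction h with
  | zero => simp
  | @cons a b s t hab _ ih =>
    by_cases hp : p a
    · rw [Multiset.filter_cons_of_pos _ hp, Multiset.filter_cons_of_pos _ ((H a b hab).1 hp)]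
      exact ih.cons hab
    · rw [Multiset.filter_cons_of_neg _ hp,
        Multiset.filter_cons_of_neg _ fun hq => hp ((H a b hab).2 hq)]
      exact ih

theorem Multiset.exists_mem_of_map_eq_map {f : α → γ} {g : β → γ} (h : s.map f = t.map g) {a : α}
    (ha : a ∈ s) : ∃ b ∈ t, f a = g b := by
  rw [← Multiset.rel_eq, Multiset.rel_map] at h
  exact Multiset.exists_mem_of_rel_of_mem h ha

end MultisetTransfer

/-! ### Stable colorings with respect to subgraph message passing -/

section SubgraphStable

open scoped Classical

variable {C S : Type} {G H : ColoredGraph C}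

/-- The neighbors of a node, as a finite set. -/
noncomputable def ColoredGraph.nbrs (G : ColoredGraph C) (v : G.V) : Finset G.V :=
  Finset.univ.filter fun w => G.graph.Adj v w

@[simp] theorem ColoredGraph.mem_nbrs (G : ColoredGraph C) {v w : G.V} :
    w ∈ G.nbrs v ↔ G.graph.Adj v w := by
  simp [ColoredGraph.nbrs]

/-- The walk is copied edge by edge with `u` and `u'` fixed, since `hnbr` moves only the second
entry; equality of the two entries signals the end. The hypotheses are separate because the lemma is
also used on the way to `SubgraphStable`. -/
theorem exists_walk_of_color_eq {c : G.V → G.V → S} {d : H.V → H.V → S}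
    (heq : ∀ u v u' v', c u v = d u' v' → (u = v ↔ u' = v'))
    (hnbr : ∀ u v u' v', c u v = d u' v' →
      (G.nbrs v).val.map (c u) = (H.nbrs v').val.map (d u'))
    {u v : G.V} (p : G.graph.Walk v u) {u' v' : H.V} (h : c u v = d u' v') :
    ∃ q : H.graph.Walk v' u', q.length = p.length := by
  induction p generalizing v' with
  | nil =>
    obtain rfl := (heq _ _ _ _ h).1 rfl
    exact ⟨.nil, rfl⟩
  | cons hadj p ih =>
    obtain ⟨w', hw', hww'⟩ := Multiset.exists_mem_of_map_eq_map (hnbr _ _ _ _ h)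
      (a := _) (G.mem_nbrs.2 hadj)
    obtain ⟨q, hq⟩ := ih hww'
    exact ⟨.cons (H.mem_nbrs.1 hw') q, by simp [hq]⟩

/-- A pair of colorings of the pairs of nodes of `G` and of `H`, compatible with each other, such
that the color of `(u, v)` determines everything that the atomic operations can see. -/
structure SubgraphStable (G H : ColoredGraph C) (c : G.V → G.V → S) (d : H.V → H.V → S) :
    Prop where
  label : ∀ u v u' v', c u v = d u' v' → G.label v = H.label v'
  eq_iff : ∀ u v u' v', c u v = d u' v' → (u = v ↔ u' = v')
  swap : ∀ u v u' v', c u v = d u' v' → c v u = d v' u'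
  diag : ∀ u v u' v', c u v = d u' v' → c u u = d u' u'
  nbrs : ∀ u v u' v', c u v = d u' v' →
    (G.nbrs v).val.map (c u) = (H.nbrs v').val.map (d u')
  row : ∀ u u', c u u = d u' u' →
    (Finset.univ : Finset G.V).val.map (c u) = (Finset.univ : Finset H.V).val.map (d u')
  diag_hist : ((Finset.univ : Finset G.V).val.map fun u => c u u) =
    (Finset.univ : Finset H.V).val.map fun u => d u u

namespace SubgraphStable

variable {c : G.V → G.V → S} {d : H.V → H.V → S}

theorem symm (h : SubgraphStable G H c d) : SubgraphStable H G d c where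
  label _ _ _ _ e := (h.label _ _ _ _ e.symm).symm
  eq_iff _ _ _ _ e := (h.eq_iff _ _ _ _ e.symm).symm
  swap _ _ _ _ e := (h.swap _ _ _ _ e.symm).symm
  diag _ _ _ _ e := (h.diag _ _ _ _ e.symm).symm
  nbrs _ _ _ _ e := (h.nbrs _ _ _ _ e.symm).symm
  row _ _ e := (h.row _ _ e.symm).symm
  diag_hist := h.diag_hist.symm

theorem edist_le (h : SubgraphStable G H c d) {u v : G.V} {u' v' : H.V} (e : c u v = d u' v') :
    H.graph.edist u' v' ≤ G.graph.edist u v := by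
  rw [SimpleGraph.edist_comm, SimpleGraph.edist_comm (u := u)]
  refine le_iInf fun p => ?_
  obtain ⟨q, hq⟩ := exists_walk_of_color_eq h.eq_iff h.nbrs p e
  exact (SimpleGraph.Walk.edist_le q).trans_eq (by rw [hq])

theorem edist_eq (h : SubgraphStable G H c d) {u v : G.V} {u' v' : H.V} (e : c u v = d u' v') :
    G.graph.edist u v = H.graph.edist u' v' :=
  le_antisymm (h.symm.edist_le e.symm) (h.edist_le e)

theorem mem_ball_iff (h : SubgraphStable G H c d) {u v : G.V} {u' v' : H.V}
    (e : c u v = d u' v') (r : ℕ) : v ∈ G.ball r u ↔ v' ∈ H.ball r u' := by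
  simp [ColoredGraph.ball, h.edist_eq e]

theorem mem_iff (h : SubgraphStable G H c d) (π : NodePolicy) {u v : G.V} {u' v' : H.V}
    (e : c u v = d u' v') : π.Mem G u v ↔ π.Mem H u' v' := by
  cases π with
  | nodeMarking => exact Iff.rfl
  | distanceEncoding => exact Iff.rfl
  | nodeDeletion => exact not_congr (h.eq_iff _ _ _ _ (h.swap _ _ _ _ e))
  | egoNetwork r => exact h.mem_ball_iff e r
  | egoNetworkMarking r => exact h.mem_ball_iff e r

theorem mark_eq (h : SubgraphStable G H c d) (π : NodePolicy) {u v : G.V} {u' v' : H.V}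
    (e : c u v = d u' v') : π.mark G u v = π.mark H u' v' := by
  have hiff := h.eq_iff _ _ _ _ (h.swap _ _ _ _ e)
  cases π with
  | nodeMarking => exact if_congr hiff rfl rfl
  | distanceEncoding => exact h.edist_eq e
  | nodeDeletion => rfl
  | egoNetwork r => rfl
  | egoNetworkMarking r => exact if_congr hiff rfl rfl

/-- The neighbors of `v` in `G^u` are the neighbors `w` in `G` that pass a membership test, and the
color of `(u, w)` decides that test. -/
theorem nbrs_policy (h : SubgraphStable G H c d) (π : NodePolicy) {u v : G.V} {u' v' : H.V}
    (e : c u v = d u' v') :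
    (π.nbrs G u v).val.map (c u) = (π.nbrs H u' v').val.map (d u') := by
  have hsplit : ∀ (K : ColoredGraph C) (x y : K.V), (π.nbrs K x y).val =
      (K.nbrs y).val.filter fun w => π.Mem K x y ∧ π.Mem K x w := by
    intro K x y
    rw [← Finset.filter_val, ColoredGraph.nbrs, Finset.filter_filter]
    rfl
  rw [hsplit, hsplit]
  exact Multiset.map_filter_eq_map_filter (h.nbrs _ _ _ _ e) fun a b hab =>
    and_congr (h.mem_iff π e) (h.mem_iff π hab)

/-- Swapping the two entries reduces the operations on the `v` side to those on the `u` side. -/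
theorem eval_eq (h : SubgraphStable G H c d) (π : NodePolicy) {F : Type} {f : G.V → G.V → F}
    {g : H.V → H.V → F} (hfg : ∀ u v u' v', c u v = d u' v' → f u v = g u' v') {u v : G.V}
    {u' v' : H.V} (e : c u v = d u' v') (o : AtomicOp) :
    o.eval π G f u v = o.eval π H g u' v' := by
  have es := h.swap _ _ _ _ e
  cases o with
  | pointUV => exact hfg _ _ _ _ e
  | pointVU => exact hfg _ _ _ _ es
  | pointUU => exact hfg _ _ _ _ (h.diag _ _ _ _ e)
  | pointVV => exact hfg _ _ _ _ (h.diag _ _ _ _ es)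
  | globalU =>
    exact Multiset.map_eq_map_of_forall_mem (h.row _ _ (h.diag _ _ _ _ e))
      fun a _ b _ hab => hfg _ _ _ _ hab
  | globalV =>
    exact Multiset.map_eq_map_of_forall_mem (h.row _ _ (h.diag _ _ _ _ es))
      fun a _ b _ hab => hfg _ _ _ _ (h.swap _ _ _ _ hab)
  | localU =>
    exact Multiset.map_eq_map_of_forall_mem (h.nbrs_policy π e)
      fun a _ b _ hab => hfg _ _ _ _ hab
  | localV =>
    exact Multiset.map_eq_map_of_forall_mem (h.nbrs_policy π es)
      fun a _ b _ hab => hfg _ _ _ _ (h.swap _ _ _ _ hab)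

theorem feature_eq (h : SubgraphStable G H c d) {a : SubgraphGNNArch} (M : SubgraphGNN C a)
    (l : ℕ) : ∀ u v u' v', c u v = d u' v' → M.feature G l u v = M.feature H l u' v' := by
  induction l with
  | zero =>
    intro u v u' v' e
    simp only [SubgraphGNN.feature]
    rw [h.label _ _ _ _ e, propext (h.mem_iff a.policy e), h.mark_eq a.policy e]
  | succ l ih =>
    intro u v u' v' e
    simp only [SubgraphGNN.feature]
    congr 1
    funext o
    exact h.eval_eq a.policy ih e o.1

/-- No subgraph GNN separates two graphs that carry compatible stable colorings. -/
theorem test (h : SubgraphStable G H c d) (a : SubgraphGNNArch) : a.test C G H := by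
  intro M
  have hf := h.feature_eq M M.depth
  unfold SubgraphGNN.output
  cases a.pool with
  | vertexSubgraph =>
    refine congrArg M.readout (Multiset.map_eq_map_of_forall_mem h.diag_hist
      fun u _ u' _ e => congrArg M.innerReadout ?_)
    exact Multiset.map_eq_map_of_forall_mem (h.row _ _ e) fun v _ v' _ e' => hf _ _ _ _ e'
  | subgraphVertex =>
    refine congrArg M.readout (Multiset.map_eq_map_of_forall_mem h.diag_hist
      fun u _ u' _ e => congrArg M.innerReadout ?_)
    exact Multiset.map_eq_map_of_forall_mem (h.row _ _ e)
      fun v _ v' _ e' => hf _ _ _ _ (h.swap _ _ _ _ e')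

end SubgraphStable

end SubgraphStable

/-! ### The `(2, 1)`-FWL+ instance and SLFWL(2) -/

section TwoOne

/-- The node type is quantified inside each alternative because one position `q` is used in both
graphs. -/
theorem nbrTuple_two_one (q : NbrIndex 2 1) :
    (∀ (V : Type) (v : Fin 2 → V) (w : Fin 1 → V), nbrTuple v w q = v) ∨
    (∀ (V : Type) (v : Fin 2 → V) (w : Fin 1 → V), nbrTuple v w q = ![w 0, v 1]) ∨
    (∀ (V : Type) (v : Fin 2 → V) (w : Fin 1 → V), nbrTuple v w q = ![v 0, w 0]) := by
  obtain ⟨⟨m, hm⟩, e, f⟩ := q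
  obtain rfl | rfl : m = 0 ∨ m = 1 := by omega
  · refine Or.inl fun V v w => funext fun i => ?_
    exact Function.extend_apply' _ _ _ fun ⟨a, _⟩ => a.elim0
  · have key : ∀ (V : Type) (v : Fin 2 → V) (w : Fin 1 → V),
        nbrTuple v w ⟨⟨1, hm⟩, e, f⟩ = Function.update v (f 0) (w 0) := by
      intro V v w
      funext i
      by_cases hi : i = f 0
      · subst hi
        rw [Function.update_self]
        refine (f.injective.extend_apply _ _ _).trans ?_
        exact congrArg w (Subsingleton.elim _ _)
      · rw [Function.update_of_ne hi]
        refine Function.extend_apply' _ _ _ ?_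
        rintro ⟨a, rfl⟩
        exact hi (congrArg f (Subsingleton.elim (α := Fin 1) a 0))
    right
    obtain h | h : f 0 = 0 ∨ f 0 = 1 := by omega
    · refine Or.inl fun V v w => ?_
      rw [key, h]
      funext i; fin_cases i <;> rfl
    · refine Or.inr fun V v w => ?_
      rw [key, h]
      funext i; fin_cases i <;> rfl

/-- The position of the neighborhood tuple in which the entry `j` is replaced. -/
def replaceIndex (j : Fin 2) : NbrIndex 2 1 :=
  ⟨1, OrderEmbedding.ofStrictMono (fun _ => 0) fun a b h =>
      absurd h (by rw [Subsingleton.elim (α := Fin 1) a b]; exact lt_irrefl _),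
    OrderEmbedding.ofStrictMono (fun _ => j) fun a b h =>
      absurd h (by rw [Subsingleton.elim (α := Fin 1) a b]; exact lt_irrefl _)⟩

theorem nbrTuple_replaceIndex {V : Type} (j : Fin 2) (v : Fin 2 → V) (w : Fin 1 → V) :
    nbrTuple v w (replaceIndex j) = Function.update v j (w 0) := by
  funext i
  by_cases hi : i = j
  · subst hi
    rw [Function.update_self]
    exact ((replaceIndex i).2.2.injective.extend_apply (w ∘ (replaceIndex i).2.1) v
      (0 : Fin 1))
  · rw [Function.update_of_ne hi]
    refine Function.extend_apply' _ _ _ ?_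
    rintro ⟨a, rfl⟩
    exact hi rfl

variable {C : Type} {G H : ColoredGraph C}

theorem isoType_eq_iff (v : Fin 2 → G.V) (v' : Fin 2 → H.V) :
    isoType G v = isoType H v' ↔ slColor G 0 (v 0) (v 1) = slColor H 0 (v' 0) (v' 1) := by
  change _ ↔ ((_, _, _, _) : C × C × Prop × Prop) = (_, _, _, _)
  unfold isoType
  simp only [Prod.mk.injEq, funext_iff, Fin.forall_fin_two, eq_iff_iff, SimpleGraph.irrefl,
    G.graph.adj_comm (v 1), H.graph.adj_comm (v' 1), eq_comm (a := v 1), eq_comm (a := v' 1)]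
  tauto

theorem ktColor_eq_iff_slColor_eq (l : ℕ) (v : Fin 2 → G.V) (v' : Fin 2 → H.V) :
    ktColor (instES C) G l v = ktColor (instES C) H l v' ↔
      slColor G l (v 0) (v 1) = slColor H l (v' 0) (v' 1) := by
  induction l generalizing v v' with
  | zero => exact isoType_eq_iff v v'
  | succ l ih =>
    -- Once the colors of the pairs themselves agree, the position `m = 0` gives no further
    -- condition.
    have key : slColor G l (v 0) (v 1) = slColor H l (v' 0) (v' 1) → ∀ (w : G.V) (w' : H.V),
        (fun q => ktColor (instES C) G l (nbrTuple v (Fin.snoc Fin.elim0 w) q)) =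
          (fun q => ktColor (instES C) H l (nbrTuple v' (Fin.snoc Fin.elim0 w') q)) ↔
        (slColor G l (v 0) w, slColor G l w (v 1)) =
          (slColor H l (v' 0) w', slColor H l w' (v' 1)) := by
      intro h w w'
      rw [Prod.mk.injEq, funext_iff]
      simp only [ih]
      constructor
      · intro hq
        refine ⟨?_, ?_⟩
        · simpa [nbrTuple_replaceIndex, Fin.snoc] using hq (replaceIndex 1)
        · simpa [nbrTuple_replaceIndex, Fin.snoc] using hq (replaceIndex 0)
      · rintro ⟨h₀, h₁⟩ q
        obtain hq | hq | hq := nbrTuple_two_one q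
        · rw [hq, hq]; exact h
        · rw [hq, hq]; exact h₁
        · rw [hq, hq]; exact h₀
    refine Prod.ext_iff.trans (Iff.trans ?_ Prod.ext_iff.symm)
    refine and_congr_left_iff.2 ?_ |>.trans (and_congr_right_iff.2 ?_)
    · intro _; exact ih v v'
    · intro h
      exact ⟨fun e => Multiset.map_eq_map_of_forall_mem e fun a _ b _ => (key h a b).1,
        fun e => Multiset.map_eq_map_of_forall_mem e fun a _ b _ => (key h a b).2⟩

theorem slHistogram_eq_map_finTwo (G : ColoredGraph C) [Fintype (Fin 2 → G.V)] (l : ℕ) :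
    slHistogram G l =
      (Finset.univ : Finset (Fin 2 → G.V)).val.map fun v => slColor G l (v 0) (v 1) := by
  rw [slHistogram, ← Finset.map_univ_equiv (finTwoArrowEquiv G.V), Finset.map_val,
    Multiset.map_map]
  rfl

theorem ktHistogram_eq_iff_slHistogram_eq (G H : ColoredGraph C) (l : ℕ) :
    ktHistogram (instES C) G l = ktHistogram (instES C) H l ↔
      slHistogram G l = slHistogram H l := by
  classical
  rw [slHistogram_eq_map_finTwo, slHistogram_eq_map_finTwo]
  exact ⟨fun e => Multiset.map_eq_map_of_forall_mem e fun v _ v' _ =>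
      (ktColor_eq_iff_slColor_eq l v v').1,
    fun e => Multiset.map_eq_map_of_forall_mem e fun v _ v' _ =>
      (ktColor_eq_iff_slColor_eq l v v').2⟩

theorem ktFWLPlus_iff_slfwl2 (G H : ColoredGraph C) :
    ktFWLPlus (instES C) G H ↔ slfwl2 C G H :=
  Filter.eventually_congr (.of_forall (ktHistogram_eq_iff_slHistogram_eq G H))

end TwoOne

/-! ### Stable colors of SLFWL(2) -/

section Stable

open scoped Classical

variable {C : Type}

/-- The stable color of a pair of nodes: the sequence of all its SLFWL(2) colors. -/
noncomputable def stableColor (G : ColoredGraph C) (u v : G.V) : (l : ℕ) → SLColor C l :=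
  fun l => slColor G l u v

@[simp] theorem ColoredGraph.mem_ball_one (G : ColoredGraph C) {v w : G.V} :
    w ∈ G.ball 1 v ↔ G.graph.Adj v w ∨ v = w := by
  simp [ColoredGraph.ball, SimpleGraph.edist_le_one_iff_adj_or_eq]

variable {G H : ColoredGraph C} {u v : G.V} {u' v' : H.V}

theorem slColor_eq_of_le {l m : ℕ} (hlm : l ≤ m) (h : slColor G m u v = slColor H m u' v') :
    slColor G l u v = slColor H l u' v' := by
  induction hlm with
  | refl => exact h
  | step _ ih => exact ih (congrArg Prod.fst h)

/-- Each color contains the previous ones, and there are finitely many pairs to compare: past the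
largest iteration that first separates two of them, nothing new is separated. -/
theorem exists_slColor_eq_imp_stableColor_eq (G H : ColoredGraph C) :
    ∃ L, ∀ (u v : G.V) (u' v' : H.V), slColor G L u v = slColor H L u' v' →
      stableColor G u v = stableColor H u' v' := by
  have hex : ∀ p : (G.V × G.V) × (H.V × H.V), ∃ l,
      slColor G l p.1.1 p.1.2 = slColor H l p.2.1 p.2.2 →
        stableColor G p.1.1 p.1.2 = stableColor H p.2.1 p.2.2 := by
    intro p
    by_contra! hne
    exact (hne 0).2 (funext fun l => (hne l).1)
  choose f hf using hex
  refine ⟨Finset.univ.sup f, fun u v u' v' h => hf ((u, v), (u', v')) ?_⟩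
  exact slColor_eq_of_le (Finset.le_sup (Finset.mem_univ _)) h

theorem stableColor_step (h : stableColor G u v = stableColor H u' v') :
    ((G.ball 1 u ∪ G.ball 1 v).val.map fun w => (stableColor G u w, stableColor G w v)) =
      (H.ball 1 u' ∪ H.ball 1 v').val.map fun w => (stableColor H u' w, stableColor H w v') := by
  obtain ⟨L, hL⟩ := exists_slColor_eq_imp_stableColor_eq G H
  refine Multiset.map_eq_map_of_forall_mem (congrArg Prod.snd (congrFun h (L + 1)))
    fun w _ w' _ e => ?_
  rw [Prod.mk.injEq] at e
  exact Prod.ext (hL _ _ _ _ e.1) (hL _ _ _ _ e.2)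

theorem stableColor_hist (h : slfwl2 C G H) :
    ((Finset.univ : Finset (G.V × G.V)).val.map fun p => stableColor G p.1 p.2) =
      (Finset.univ : Finset (H.V × H.V)).val.map fun p => stableColor H p.1 p.2 := by
  obtain ⟨L, hL⟩ := exists_slColor_eq_imp_stableColor_eq G H
  obtain ⟨N, hN⟩ := Filter.eventually_atTop.1 h
  refine Multiset.map_eq_map_of_forall_mem (hN (max N L) (le_max_left _ _))
    fun p _ p' _ e => hL _ _ _ _ (slColor_eq_of_le (le_max_right _ _) e)

/-! ### Information contained in a stable color -/

theorem stableColor_zero (h : stableColor G u v = stableColor H u' v') :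
    G.label u = H.label u' ∧ G.label v = H.label v' ∧ (u = v ↔ u' = v') ∧
      (G.graph.Adj u v ↔ H.graph.Adj u' v') := by
  have h0 : ((_, _, _, _) : C × C × Prop × Prop) = (_, _, _, _) := congrFun h 0
  simpa only [Prod.mk.injEq, eq_iff_iff] using h0

theorem stableColor_eq_iff (h : stableColor G u v = stableColor H u' v') : u = v ↔ u' = v' :=
  (stableColor_zero h).2.2.1

theorem stableColor_adj_iff (h : stableColor G u v = stableColor H u' v') :
    G.graph.Adj u v ↔ H.graph.Adj u' v' :=
  (stableColor_zero h).2.2.2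

/-- The node `w = u` occurs in the aggregation, and its partner `w'` must be `u'` because colors
detect equality. -/
theorem stableColor_diag (h : stableColor G u v = stableColor H u' v') :
    stableColor G u u = stableColor H u' u' := by
  obtain ⟨w', -, e⟩ := Multiset.exists_mem_of_map_eq_map (stableColor_step h) (a := u) (by simp)
  rw [Prod.mk.injEq] at e
  obtain rfl := (stableColor_eq_iff e.1).1 rfl
  exact e.1

theorem slColor_swap (l : ℕ) : ∀ {u v : G.V} {u' v' : H.V},
    slColor G l u v = slColor H l u' v' → slColor G l v u = slColor H l v' u' := by
  induction l with
  | zero =>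
    intro u v u' v' h
    have h0 : ((_, _, _, _) : C × C × Prop × Prop) = (_, _, _, _) := h
    change ((_, _, _, _) : C × C × Prop × Prop) = (_, _, _, _)
    rw [Prod.mk.injEq, Prod.mk.injEq, Prod.mk.injEq] at h0 ⊢
    rw [eq_comm (a := v), eq_comm (a := v'), G.graph.adj_comm, H.graph.adj_comm]
    exact ⟨h0.2.1, h0.1, h0.2.2⟩
  | succ l ih =>
    intro u v u' v' h
    refine Prod.ext (ih (congrArg Prod.fst h)) ?_
    change Multiset.map _ (G.ball 1 v ∪ G.ball 1 u).val =
      Multiset.map _ (H.ball 1 v' ∪ H.ball 1 u').val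
    rw [Finset.union_comm, Finset.union_comm (H.ball 1 v')]
    refine Multiset.map_eq_map_of_forall_mem (congrArg Prod.snd h) fun w _ w' _ e => ?_
    rw [Prod.mk.injEq] at e
    exact Prod.ext (ih e.2) (ih e.1)

theorem stableColor_swap (h : stableColor G u v = stableColor H u' v') :
    stableColor G v u = stableColor H v' u' :=
  funext fun l => slColor_swap l (congrFun h l)

/-- Neighbors of `v` lie in the aggregated set and are recognized by the color of `(w, v)`. Both
colors are kept together; this joint information is what detects triangles. -/
theorem stableColor_nbrs (h : stableColor G u v = stableColor H u' v') :
    (G.nbrs v).val.map (fun w => (stableColor G u w, stableColor G w v)) =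
      (H.nbrs v').val.map fun w => (stableColor H u' w, stableColor H w v') := by
  have hsplit : ∀ (K : ColoredGraph C) (x y : K.V), (K.nbrs y).val =
      (K.ball 1 x ∪ K.ball 1 y).val.filter fun w => K.graph.Adj w y := by
    intro K x y
    rw [← Finset.filter_val]
    congr 1
    ext w
    simp only [ColoredGraph.mem_nbrs, Finset.mem_filter, Finset.mem_union,
      ColoredGraph.mem_ball_one, K.graph.adj_comm w]
    tauto
  rw [hsplit G u v, hsplit H u' v']
  refine Multiset.map_filter_eq_map_filter (stableColor_step h) fun w w' e => ?_
  rw [Prod.mk.injEq] at e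
  exact stableColor_adj_iff e.2

theorem stableColor_nbrs_fst (h : stableColor G u v = stableColor H u' v') :
    (G.nbrs v).val.map (stableColor G u) = (H.nbrs v').val.map (stableColor H u') :=
  Multiset.map_eq_map_of_forall_mem (stableColor_nbrs h) fun _ _ _ _ e => congrArg Prod.fst e

theorem stableColor_diag_hist (h : slfwl2 C G H) :
    ((Finset.univ : Finset G.V).val.map fun u => stableColor G u u) =
      (Finset.univ : Finset H.V).val.map fun u => stableColor H u u := by
  have hdiag : ∀ K : ColoredGraph C,
      ((Finset.univ : Finset K.V).val.map fun u => stableColor K u u) =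
        ((Finset.univ : Finset (K.V × K.V)).val.filter fun p => p.1 = p.2).map
          fun p => stableColor K p.1 p.2 := by
    intro K
    have : (Finset.univ : Finset (K.V × K.V)).filter (fun p => p.1 = p.2) =
        Finset.univ.map ⟨fun u : K.V => (u, u), fun a b e => congrArg Prod.fst e⟩ := by
      ext ⟨a, b⟩
      simp only [Finset.mem_filter, Finset.mem_univ, true_and, Finset.mem_map]
      exact ⟨fun e => ⟨a, congrArg (Prod.mk a) e⟩,
        fun ⟨_, e⟩ => (congrArg Prod.fst e).symm.trans (congrArg Prod.snd e)⟩
    rw [← Finset.filter_val, this, Finset.map_val, Multiset.map_map]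
    rfl
  rw [hdiag, hdiag]
  exact Multiset.map_filter_eq_map_filter (stableColor_hist h) fun _ _ e => stableColor_eq_iff e

/-! ### Aggregation over all nodes -/

theorem stableColor_reachable (h : stableColor G u v = stableColor H u' v')
    (huv : G.graph.Reachable u v) : H.graph.Reachable u' v' := by
  obtain ⟨p⟩ := huv.symm
  obtain ⟨q, -⟩ := exists_walk_of_color_eq (fun _ _ _ _ => stableColor_eq_iff)
    (fun _ _ _ _ => stableColor_nbrs_fst) p h
  exact ⟨q.reverse⟩

theorem stableColor_reachable_iff (h : stableColor G u v = stableColor H u' v') :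
    G.graph.Reachable u v ↔ H.graph.Reachable u' v' :=
  ⟨stableColor_reachable h, stableColor_reachable h.symm⟩

/-- The nodes `x` such that `(u, x)` has the stable color `s`. -/
noncomputable def colorClass (G : ColoredGraph C) (u : G.V) (s : (l : ℕ) → SLColor C l) :
    Finset G.V :=
  Finset.univ.filter fun x => stableColor G u x = s

@[simp] theorem mem_colorClass {s : (l : ℕ) → SLColor C l} :
    v ∈ colorClass G u s ↔ stableColor G u v = s := by
  simp [colorClass]

theorem card_nbrs_colorClass (h : stableColor G u v = stableColor H u' v')
    (t : (l : ℕ) → SLColor C l) :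
    ((colorClass G u t).filter fun b => G.graph.Adj v b).card =
      ((colorClass H u' t).filter fun b => H.graph.Adj v' b).card := by
  have hcount : ∀ (K : ColoredGraph C) (x y : K.V),
      ((colorClass K x t).filter fun b => K.graph.Adj y b).card =
        ((K.nbrs y).val.map (stableColor K x)).count t := by
    intro K x y
    rw [Multiset.count_map, ← Finset.filter_val, Finset.card_val]
    congr 1
    ext w
    simp [and_comm, eq_comm]
  rw [hcount, hcount, stableColor_nbrs_fst h]

/-- Double counting of the edges of `H` between two color classes. The degrees are read off in `G`,
so the identity has the same coefficients for `H` as for `G` itself (take `u' = u`). -/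
theorem card_colorClass_mul (u v y : G.V) (u' : H.V) :
    (colorClass H u' (stableColor G u v)).card *
        ((colorClass G u (stableColor G u y)).filter fun b => G.graph.Adj v b).card =
      (colorClass H u' (stableColor G u y)).card *
        ((colorClass G u (stableColor G u v)).filter fun b => G.graph.Adj y b).card := by
  refine Finset.card_mul_eq_card_mul (fun a b => H.graph.Adj a b) (fun a ha => ?_)
    fun b hb => ?_
  · exact card_nbrs_colorClass (mem_colorClass.1 ha) _
  · rw [← card_nbrs_colorClass (mem_colorClass.1 hb), Finset.bipartiteBelow]
    simp only [H.graph.adj_comm _ b]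

theorem card_colorClass_eq (h : stableColor G u u = stableColor H u' u')
    (hw : G.graph.Reachable u v) :
    (colorClass G u (stableColor G u v)).card = (colorClass H u' (stableColor G u v)).card := by
  rw [SimpleGraph.reachable_iff_reflTransGen] at hw
  induction hw with
  | refl =>
    have hG : colorClass G u (stableColor G u u) = {u} := by
      ext x
      simp only [mem_colorClass, Finset.mem_singleton]
      exact ⟨fun e => ((stableColor_eq_iff e).2 rfl).symm, fun e => by rw [e]⟩
    have hH : colorClass H u' (stableColor G u u) = {u'} := by
      ext x
      simp only [mem_colorClass, Finset.mem_singleton]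
      exact ⟨fun e => ((stableColor_eq_iff e).2 rfl).symm, fun e => by rw [e, h]⟩
    rw [hG, hH, Finset.card_singleton, Finset.card_singleton]
  | @tail w x _ hwx ih =>
    -- The edge from `w` to `x` makes the coefficient to be cancelled nonzero.
    have hpos : 0 < ((colorClass G u (stableColor G u w)).filter
        fun b => G.graph.Adj x b).card :=
      Finset.card_pos.2 ⟨w, Finset.mem_filter.2 ⟨mem_colorClass.2 rfl, hwx.symm⟩⟩
    refine Nat.eq_of_mul_eq_mul_right hpos ?_
    rw [← card_colorClass_mul u w x u, ← card_colorClass_mul u w x u', ih]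

/-- A color that occurs in the component of `u` occurs only at reachable nodes, in both graphs, so
its multiplicity is the size of its class. Colors absent from the component are why only an
inequality is shown; symmetry gives the converse. -/
theorem count_component_le (h : stableColor G u u = stableColor H u' u')
    (t : (l : ℕ) → SLColor C l) :
    ((Finset.univ.filter fun w => G.graph.Reachable u w).val.map (stableColor G u)).count t ≤
      ((Finset.univ.filter fun w => H.graph.Reachable u' w).val.map
        (stableColor H u')).count t := by
  by_cases ht : ∃ w, G.graph.Reachable u w ∧ stableColor G u w = t
  · obtain ⟨w, hw, rfl⟩ := ht
    have hcount : ∀ (K : ColoredGraph C) (x : K.V), (∀ y, stableColor K x y = stableColor G u w →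
        K.graph.Reachable x y) → ((Finset.univ.filter fun w => K.graph.Reachable x w).val.map
          (stableColor K x)).count (stableColor G u w) =
        (colorClass K x (stableColor G u w)).card := by
      intro K x hK
      rw [Multiset.count_map, ← Finset.filter_val, Finset.card_val]
      congr 1
      ext y
      simp only [Finset.mem_filter, Finset.mem_univ, true_and, mem_colorClass]
      exact ⟨fun e => e.2.symm, fun e => ⟨hK y e, e.symm⟩⟩
    rw [hcount G u fun y e => (stableColor_reachable_iff e).2 hw,
      hcount H u' fun y e => (stableColor_reachable_iff e).2 hw, card_colorClass_eq h hw]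
  · rw [Multiset.count_eq_zero_of_notMem]
    · exact Nat.zero_le _
    · simpa using ht

theorem stableColor_component (h : stableColor G u u = stableColor H u' u') :
    (Finset.univ.filter fun w => G.graph.Reachable u w).val.map (stableColor G u) =
      (Finset.univ.filter fun w => H.graph.Reachable u' w).val.map (stableColor H u') :=
  Multiset.ext.2 fun t => le_antisymm (count_component_le h t) (count_component_le h.symm t)

/-- The color of a pair of nodes in different components is determined by the colors of the two
nodes. -/
theorem slColor_eq_of_not_reachable (l : ℕ) : ∀ {u v : G.V} {u' v' : H.V},
    ¬ G.graph.Reachable u v → ¬ H.graph.Reachable u' v' →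
    stableColor G u u = stableColor H u' u' → stableColor G v v = stableColor H v' v' →
    slColor G l u v = slColor H l u' v' := by
  induction l with
  | zero =>
    intro u v u' v' huv huv' hu hv
    change ((_, _, _, _) : C × C × Prop × Prop) = (_, _, _, _)
    rw [(stableColor_zero hu).1, (stableColor_zero hv).1,
      eq_false (fun e => huv (e ▸ .rfl) : u ≠ v), eq_false (fun e => huv' (e ▸ .rfl) : u' ≠ v'),
      eq_false fun e => huv (SimpleGraph.Adj.reachable e),
      eq_false fun e => huv' (SimpleGraph.Adj.reachable e)]
  | succ l ih =>
    intro u v u' v' huv huv' hu hv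
    have reach : ∀ (K : ColoredGraph C) {x y : K.V}, y ∈ (K.ball 1 x).val →
        K.graph.Reachable x y := by
      intro K x y hy
      rcases K.mem_ball_one.1 hy with e | rfl
      · exact e.reachable
      · exact .rfl
    have hsplit : ∀ (K : ColoredGraph C) (x y : K.V), ¬ K.graph.Reachable x y →
        (K.ball 1 x ∪ K.ball 1 y).val = (K.ball 1 x).val + (K.ball 1 y).val := by
      intro K x y hxy
      rw [← Finset.disjUnion_eq_union _ _ (Finset.disjoint_left.2 fun w hx hy =>
        hxy ((reach K hx).trans (reach K hy).symm))]
      rfl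
    have hball : ∀ {x : G.V} {x' : H.V}, stableColor G x x = stableColor H x' x' →
        (G.ball 1 x).val.map (fun w => (stableColor G x w, stableColor G w x)) =
          (H.ball 1 x').val.map fun w => (stableColor H x' w, stableColor H w x') := by
      intro x x' hx
      simpa only [Finset.union_idempotent] using stableColor_step hx
    refine Prod.ext (ih huv huv' hu hv) ?_
    change Multiset.map _ (G.ball 1 u ∪ G.ball 1 v).val =
      Multiset.map _ (H.ball 1 u' ∪ H.ball 1 v').val
    rw [hsplit _ _ _ huv, hsplit _ _ _ huv', Multiset.map_add, Multiset.map_add]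
    congr 1
    · refine Multiset.map_eq_map_of_forall_mem (hball hu) fun w hw w' hw' e => ?_
      rw [Prod.mk.injEq] at e
      exact Prod.ext (congrFun e.1 l) (ih (fun r => huv ((reach G hw).trans r))
        (fun r => huv' ((reach H hw').trans r)) (stableColor_diag e.2) hv)
    · refine Multiset.map_eq_map_of_forall_mem (hball hv) fun w hw w' hw' e => ?_
      rw [Prod.mk.injEq] at e
      exact Prod.ext (ih (fun r => huv (r.trans (reach G hw).symm))
        (fun r => huv' (r.trans (reach H hw').symm)) hu (stableColor_diag e.2))
        (congrFun e.2 l)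

theorem stableColor_row (hG : slfwl2 C G H) (h : stableColor G u u = stableColor H u' u') :
    (Finset.univ : Finset G.V).val.map (stableColor G u) =
      (Finset.univ : Finset H.V).val.map (stableColor H u') := by
  have hcomp := stableColor_component h
  have hsplit : ∀ (K : ColoredGraph C) (x : K.V), (Finset.univ : Finset K.V).val =
      (Finset.univ.filter fun w => K.graph.Reachable x w).val +
        (Finset.univ.filter fun w => ¬ K.graph.Reachable x w).val := by
    intro K x
    rw [Finset.filter_val, Finset.filter_val, Multiset.filter_add_not]
  have hdiag := stableColor_diag_hist hG
  rw [hsplit G u, hsplit H u', Multiset.map_add, Multiset.map_add] at hdiag ⊢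
  rw [hcomp]
  congr 1
  -- Removing the matched components from the diagonal histogram leaves equal diagonal histograms of
  -- the complements.
  rw [Multiset.map_eq_map_of_forall_mem hcomp fun w _ w' _ e =>
    stableColor_diag (stableColor_swap e)] at hdiag
  refine Multiset.map_eq_map_of_forall_mem (add_left_cancel hdiag) fun w hw w' hw' e => ?_
  exact funext fun l => slColor_eq_of_not_reachable l (Finset.mem_filter.1 hw).2
    (Finset.mem_filter.1 hw').2 h e

theorem subgraphStable_stableColor (h : slfwl2 C G H) :
    SubgraphStable G H (stableColor G) (stableColor H) where
  label _ _ _ _ e := (stableColor_zero e).2.1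
  eq_iff _ _ _ _ := stableColor_eq_iff
  swap _ _ _ _ := stableColor_swap
  diag _ _ _ _ := stableColor_diag
  nbrs _ _ _ _ := stableColor_nbrs_fst
  row _ _ := stableColor_row h
  diag_hist := stableColor_diag_hist h

/-! ### A property that SLFWL(2) detects -/

/-- Some triangle has three edges each of which lies in at least three triangles. -/
def HasHeavyTriangle (G : ColoredGraph C) : Prop :=
  ∃ u v w : G.V, (G.graph.Adj u v ∧ G.graph.Adj w u ∧ G.graph.Adj w v) ∧
    3 ≤ ((G.nbrs v).filter fun x => G.graph.Adj u x).card ∧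
    3 ≤ ((G.nbrs u).filter fun x => G.graph.Adj w x).card ∧
    3 ≤ ((G.nbrs v).filter fun x => G.graph.Adj w x).card

theorem card_commonNbrs_eq (h : stableColor G u v = stableColor H u' v') :
    ((G.nbrs v).filter fun x => G.graph.Adj u x).card =
      ((H.nbrs v').filter fun x => H.graph.Adj u' x).card := by
  have e := congrArg Multiset.card (Multiset.map_filter_eq_map_filter (stableColor_nbrs_fst h)
    fun _ _ e => stableColor_adj_iff e)
  rwa [Multiset.card_map, Multiset.card_map] at e

/-- A single partner `w'` matches the colors of `(u, w)` and `(w, v)` simultaneously. -/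
theorem HasHeavyTriangle.of_slfwl2 (h : slfwl2 C G H) (hG : HasHeavyTriangle G) :
    HasHeavyTriangle H := by
  obtain ⟨u, v, w, ⟨huv, hwu, hwv⟩, h₁, h₂, h₃⟩ := hG
  obtain ⟨⟨u', v'⟩, -, e⟩ := Multiset.exists_mem_of_map_eq_map (stableColor_hist h)
    (a := (u, v)) (Finset.mem_univ _)
  obtain ⟨w', -, e'⟩ := Multiset.exists_mem_of_map_eq_map (stableColor_nbrs e) (a := w)
    (G.mem_nbrs.2 hwv.symm)
  rw [Prod.mk.injEq] at e'
  have e'' := stableColor_swap e'.1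
  refine ⟨u', v', w', ⟨(stableColor_adj_iff e).1 huv, (stableColor_adj_iff e'').1 hwu,
    (stableColor_adj_iff e'.2).1 hwv⟩, ?_, ?_, ?_⟩
  · exact h₁.trans_eq (card_commonNbrs_eq e)
  · exact h₂.trans_eq (card_commonNbrs_eq e'')
  · exact h₃.trans_eq (card_commonNbrs_eq e'.2)

end Stable

/-! ### Two graphs that only SLFWL(2) separates

The base graph is a triangle with an additional common neighbor (an ear) for each of its edges. The
two graphs are its Fürer graphs. A center `x ∈ {0, 1, 2}` of the base graph gives the eight nodes
`8 x + k`, one for each even set of base edges at `x`: the bits `0` and `1` of `k` stand for the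
edges to the centers `x + 1` and `x - 1`, the bit `2` for the edge to the ear `x` (between the
centers `x` and `x + 1`), and the edge to the ear `x - 1` has the parity of the other three. An ear
`x` gives the nodes `24 + 2 x` and `25 + 2 x`. -/

/-- The bit of a center node for the edge to the ear before the center. -/
def sunPrevEarBit (i : ℕ) : Bool :=
  (i.testBit 0 ^^ i.testBit 1) ^^ i.testBit 2

/-- The color of a center node and an ear node. -/
def sunCenterEarColor (i j : ℕ) : ℕ :=
  match ((j - 24) / 2 + 3 - i / 8) % 3 with
  | 0 => 16 + (i.testBit 2 ^^ j.testBit 0).toNat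
  | 1 => 20
  | _ => 18 + (sunPrevEarBit i ^^ j.testBit 0).toNat

/-- The color of two center nodes. -/
def sunCenterColor (t : Bool) (i j : ℕ) : ℕ :=
  match (j / 8 + 3 - i / 8) % 3 with
  | 0 => (i ^^^ j) % 8
  | 1 => 8 + 2 * ((i.testBit 0 ^^ j.testBit 1) ^^ (t && i / 8 == 0)).toNat +
      (i.testBit 2 ^^ sunPrevEarBit j).toNat
  | _ => 12 + 2 * ((i.testBit 1 ^^ j.testBit 0) ^^ (t && j / 8 == 0)).toNat +
      (sunPrevEarBit i ^^ j.testBit 2).toNat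

/-- The color of two ear nodes. -/
def sunEarColor (i j : ℕ) : ℕ :=
  match ((j - 24) / 2 + 3 - (i - 24) / 2) % 3 with
  | 0 => 26 + (i.testBit 0 ^^ j.testBit 0).toNat
  | 1 => 28
  | _ => 29

/-- The color of a pair of nodes; `t` tells whether the base edge between the centers `0` and `1` is
twisted. -/
def sunColor (t : Bool) (i j : ℕ) : ℕ :=
  bif Nat.blt i 24 then
    bif Nat.blt j 24 then sunCenterColor t i j else sunCenterEarColor i j
  else
    bif Nat.blt j 24 then 5 + sunCenterEarColor j i else sunEarColor i j

/-- The colors of the pairs of adjacent nodes: these are 8, 9, 12, 13, 16, 18, 21, 23. -/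
def isSunEdge (k : ℕ) : Bool :=
  Nat.testBit 10826496 k

/-- The colors of the pairs of adjacent nodes with at least three common neighbors. -/
def isSunHeavyEdge (k : ℕ) : Bool :=
  k == 8 || k == 12

/-- Pairs of nodes of the untwisted graph with the colors `0, 1, 2, …`. -/
def sunReps : List (ℕ × ℕ) :=
  [(0, 0), (0, 1), (0, 2), (0, 3), (0, 4), (0, 5), (0, 6), (0, 7),
    (0, 8), (0, 9), (0, 11), (0, 10), (0, 16), (0, 20), (0, 17), (0, 21),
    (0, 24), (0, 25), (0, 28), (0, 29), (0, 26), (24, 0), (25, 0), (28, 0), (29, 0), (26, 0),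
    (24, 24), (24, 25), (24, 26), (24, 28)]

/-- The value of `f` at the pair of `sunReps` with the color `k`. -/
def sunRepValue (f : ℕ → ℕ → ℕ) (k : ℕ) : ℕ :=
  (sunReps.map fun p => f p.1 p.2).getD k 0

/-- The colors of the pairs `(i, w)` for the neighbors `w` of `j`. -/
def sunNbrColors (t : Bool) (i j : ℕ) : List ℕ :=
  ((List.range 30).filter fun w => isSunEdge (sunColor t j w)).map (sunColor t i)

/-- The colors of the pairs `(i, w)` for all nodes `w`. -/
def sunRowColors (t : Bool) (i : ℕ) : List ℕ :=
  (List.range 30).map (sunColor t i)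

/-- The sum is the number whose base `b` digits are the multiplicities, and these are less than `b`.
Equality of multisets thus becomes equality of two numbers, which the kernel evaluates quickly. -/
theorem List.perm_of_sum_pow_eq {b : ℕ} (hb : 1 < b) {l₁ l₂ : List ℕ} (h₁ : l₁.length < b)
    (h₂ : l₂.length < b) (h : (l₁.map (b ^ ·)).sum = (l₂.map (b ^ ·)).sum) : l₁.Perm l₂ := by
  obtain ⟨n, hn⟩ : ∃ n, ∀ k ∈ l₁ ++ l₂, k < n :=
    ⟨(l₁ ++ l₂).sum + 1, fun k hk => Nat.lt_succ_of_le (List.le_sum_of_mem hk)⟩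
  have hsum : ∀ l : List ℕ, (∀ k ∈ l, k < n) →
      (l.map (b ^ ·)).sum = Nat.ofDigits b ((List.range n).map fun k => l.count k) := by
    intro l hl
    have hdig : ∀ m, Nat.ofDigits b ((List.range m).map fun k => l.count k) =
        ∑ k ∈ Finset.range m, l.count k * b ^ k := by
      intro m
      induction m with
      | zero => rfl
      | succ m ih =>
        rw [List.range_succ, List.map_append, Nat.ofDigits_append, ih, Finset.sum_range_succ]
        simp [Nat.ofDigits_singleton, mul_comm]
    rw [hdig, Finset.sum_list_map_count]
    refine Finset.sum_subset (fun k hk => Finset.mem_range.2 (hl k (List.mem_toFinset.1 hk)))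
      fun k _ hk => ?_
    rw [List.count_eq_zero_of_not_mem fun hm => hk (List.mem_toFinset.2 hm), zero_smul]
  have hdigits := Nat.ofDigits_inj_of_len_eq hb (by simp)
    (by simpa using fun k _ => List.count_le_length.trans_lt h₁)
    (by simpa using fun k _ => List.count_le_length.trans_lt h₂)
    ((hsum l₁ fun k hk => hn k (List.mem_append_left _ hk)).symm.trans
      (h.trans (hsum l₂ fun k hk => hn k (List.mem_append_right _ hk))))
  refine List.perm_iff_count.2 fun k => ?_
  by_cases hk : k < n
  · exact List.map_inj_left.1 hdigits k (List.mem_range.2 hk)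
  · rw [List.count_eq_zero_of_not_mem fun hm => hk (hn k (List.mem_append_left _ hm)),
      List.count_eq_zero_of_not_mem fun hm => hk (hn k (List.mem_append_right _ hm))]

/-! ### Finite checks on the coloring -/

/-- Comparing every pair, in either graph, with the untwisted representative of its color shows that
the quantity depends on the color alone. This avoids comparing pairs with pairs; the checks below
have the same form. -/
theorem sunColor_swap : ∀ t, ∀ i < 30, ∀ j < 30,
    sunColor t j i = sunRepValue (fun i j => sunColor false j i) (sunColor t i j) := by
  decide +kernel

theorem sunColor_diag : ∀ t, ∀ i < 30, ∀ j < 30,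
    sunColor t i i = sunRepValue (fun i _ => sunColor false i i) (sunColor t i j) := by
  decide +kernel

theorem sunColor_eq_iff : ∀ t, ∀ i < 30, ∀ j < 30,
    i = j ↔ sunColor t i j = 0 ∨ sunColor t i j = 26 := by
  decide +kernel

theorem sunNbrColors_sum : ∀ t, ∀ i < 30, ∀ j < 30, ((sunNbrColors t i j).map (32 ^ ·)).sum =
    sunRepValue (fun i j => ((sunNbrColors false i j).map (32 ^ ·)).sum) (sunColor t i j) := by
  decide +kernel

theorem sunRowColors_sum : ∀ t, ∀ i < 30, ((sunRowColors t i).map (32 ^ ·)).sum =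
    sunRepValue (fun i _ => ((sunRowColors false i).map (32 ^ ·)).sum) (sunColor t i i) := by
  decide +kernel

/-- Adjacent center nodes have two common neighbors at the third center, and a third one at their
ear exactly when their ear bits agree. A center node and an adjacent ear node have only two. -/
theorem sunNbrColors_countP : ∀ t, ∀ i < 30, ∀ j < 30, isSunEdge (sunColor t i j) →
    3 ≤ (sunNbrColors t i j).countP isSunEdge → isSunHeavyEdge (sunColor t i j) := by
  decide +kernel

/-- Such a triangle has one node at each center. Adding all their bits gives zero, as each node is
an even set; adding them edge by edge gives one, because only the twisted edge contributes. -/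
theorem sunColor_no_triangle : ∀ i < 30, ∀ j < 30,
    isSunHeavyEdge (sunColor true i j) → ∀ k < 30,
      ¬ (isSunHeavyEdge (sunColor true k i) ∧ isSunHeavyEdge (sunColor true k j)) := by
  decide +kernel

theorem sunColor_diag_twist (t : Bool) : ∀ i < 30, sunColor t i i = sunColor false i i := by
  decide +revert +kernel

theorem isSunEdge_symm (t : Bool) : ∀ i < 30, ∀ j < 30,
    isSunEdge (sunColor t i j) = isSunEdge (sunColor t j i) := by
  decide +revert +kernel

theorem isSunEdge_irrefl (t : Bool) : ∀ i < 30, isSunEdge (sunColor t i i) = false := by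
  decide +revert +kernel

/-- The Fürer graph (`t = false`) and the twisted Fürer graph (`t = true`), with a single node
color. -/
def sunGraph {C : Type} (a : C) (t : Bool) : ColoredGraph C where
  V := Fin 30
  graph :=
    { Adj := fun i j => isSunEdge (sunColor t i j)
      symm := ⟨fun i j h => (isSunEdge_symm t j j.2 i i.2).trans h⟩
      loopless := ⟨fun i h => absurd h (by simp [isSunEdge_irrefl t i i.2])⟩ }
  label := fun _ => a

/-! ### The two Fürer graphs as colored graphs -/

section SunGraph

open scoped Classical

variable {C : Type} {a : C} {t t' : Bool}

/-- The number of a node. -/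
def sunNode (i : (sunGraph a t).V) : ℕ :=
  Fin.val (n := 30) i

theorem sunNode_lt (i : (sunGraph a t).V) : sunNode i < 30 :=
  Fin.isLt (n := 30) i

theorem sunNode_inj {i j : (sunGraph a t).V} : i = j ↔ sunNode i = sunNode j :=
  Fin.ext_iff (n := 30)

theorem sunGraph_adj {i j : (sunGraph a t).V} :
    (sunGraph a t).graph.Adj i j ↔ isSunEdge (sunColor t (sunNode i) (sunNode j)) :=
  Iff.rfl

/-- The color of a pair of nodes of `sunGraph a t`. -/
def sunGraphColor (i j : (sunGraph a t).V) : ℕ :=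
  sunColor t (sunNode i) (sunNode j)

theorem sunGraph_univ_map_sunNode :
    (Finset.univ : Finset (sunGraph a t).V).val.map sunNode = (List.range 30 : Multiset ℕ) := by
  rw [← List.map_coe_finRange_eq_range]
  rfl

theorem sunGraph_nbrs_map (i j : (sunGraph a t).V) :
    ((sunGraph a t).nbrs j).val.map (sunGraphColor i) =
      (sunNbrColors t (sunNode i) (sunNode j) : Multiset ℕ) := by
  have hfilter : (List.range 30).filter (fun w => isSunEdge (sunColor t (sunNode j) w)) =
      (List.range 30).filter fun w => decide (isSunEdge (sunColor t (sunNode j) w) = true) :=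
    List.filter_congr fun w _ => Bool.decide_eq_true.symm
  rw [sunNbrColors, hfilter, ← Multiset.map_coe, ← Multiset.filter_coe, ← sunGraph_univ_map_sunNode (a := a),
    Multiset.filter_map, Multiset.map_map, ColoredGraph.nbrs, Finset.filter_val]
  refine (Multiset.map_congr (Multiset.filter_congr fun w _ => ?_) fun w _ => ?_)
  · exact sunGraph_adj
  · rfl

theorem sunGraph_univ_map (i : (sunGraph a t).V) :
    (Finset.univ : Finset (sunGraph a t).V).val.map (sunGraphColor i) =
      (sunRowColors t (sunNode i) : Multiset ℕ) := by
  rw [sunRowColors, ← Multiset.map_coe, ← sunGraph_univ_map_sunNode (a := a), Multiset.map_map]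
  rfl

theorem sunGraphColor_transfer {f : ℕ → ℕ} {i j : (sunGraph a t).V}
    {i' j' : (sunGraph a t').V} (e : sunGraphColor i j = sunGraphColor i' j') {x y : ℕ}
    (hx : x = f (sunColor t (sunNode i) (sunNode j)))
    (hy : y = f (sunColor t' (sunNode i') (sunNode j'))) : x = y :=
  hx.trans ((congrArg f e).trans hy.symm)

theorem subgraphStable_sunGraph (a : C) (t t' : Bool) :
    SubgraphStable (sunGraph a t) (sunGraph a t') sunGraphColor sunGraphColor where
  label _ _ _ _ _ := rfl
  eq_iff i j i' j' e := by
    rw [sunNode_inj, sunNode_inj, sunColor_eq_iff t _ (sunNode_lt i) _ (sunNode_lt j),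
      sunColor_eq_iff t' _ (sunNode_lt i') _ (sunNode_lt j')]
    change sunGraphColor i j = 0 ∨ sunGraphColor i j = 26 ↔ _
    rw [e]
    rfl
  swap i j i' j' e := sunGraphColor_transfer e
    (sunColor_swap t _ (sunNode_lt i) _ (sunNode_lt j))
    (sunColor_swap t' _ (sunNode_lt i') _ (sunNode_lt j'))
  diag i j i' j' e := sunGraphColor_transfer e
    (sunColor_diag t _ (sunNode_lt i) _ (sunNode_lt j))
    (sunColor_diag t' _ (sunNode_lt i') _ (sunNode_lt j'))
  nbrs i j i' j' e := by
    -- There are only 30 nodes, so no multiplicity reaches the base 32.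
    have hlen : ∀ t i j, (sunNbrColors t i j).length < 32 := fun t i j => by
      rw [sunNbrColors, List.length_map]
      exact (List.length_filter_le _ _).trans_lt (by simp)
    rw [sunGraph_nbrs_map, sunGraph_nbrs_map, Multiset.coe_eq_coe]
    exact List.perm_of_sum_pow_eq (by norm_num) (hlen _ _ _) (hlen _ _ _) <|
      sunGraphColor_transfer e
        (sunNbrColors_sum t _ (sunNode_lt i) _ (sunNode_lt j))
        (sunNbrColors_sum t' _ (sunNode_lt i') _ (sunNode_lt j'))
  row i i' e := by
    have hlen : ∀ t i, (sunRowColors t i).length < 32 := fun t i => by simp [sunRowColors]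
    rw [sunGraph_univ_map, sunGraph_univ_map, Multiset.coe_eq_coe]
    exact List.perm_of_sum_pow_eq (by norm_num) (hlen _ _) (hlen _ _) <|
      sunGraphColor_transfer e (sunRowColors_sum t _ (sunNode_lt i))
        (sunRowColors_sum t' _ (sunNode_lt i'))
  diag_hist := by
    have hdiag : ∀ t, ((Finset.univ : Finset (sunGraph a t).V).val.map
        fun i => sunGraphColor i i) = (List.range 30 : Multiset ℕ).map
          fun i => sunColor false i i := by
      intro t
      rw [← sunGraph_univ_map_sunNode (a := a) (t := t), Multiset.map_map]
      exact Multiset.map_congr rfl fun i _ => sunColor_diag_twist t _ (sunNode_lt i)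
    rw [hdiag, hdiag]

theorem sunGraph_card_commonNbrs (i j : (sunGraph a t).V) :
    (((sunGraph a t).nbrs j).filter fun x => (sunGraph a t).graph.Adj i x).card =
      (sunNbrColors t (sunNode i) (sunNode j)).countP isSunEdge := by
  have hcount : ∀ l : List ℕ, l.countP isSunEdge = l.countP fun k => decide (isSunEdge k = true) :=
    fun l => List.countP_congr fun k _ => by simp
  rw [hcount, ← Multiset.coe_countP, ← sunGraph_nbrs_map, Multiset.countP_map, ← Finset.filter_val]
  refine congrArg Finset.card (Finset.filter_congr fun w _ => ?_)
  exact sunGraph_adj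

theorem hasHeavyTriangle_sunGraph (a : C) : HasHeavyTriangle (sunGraph a false) := by
  -- The nodes 0, 8 and 16 are the empty edge sets at the three centers, so all their bits agree.
  have hadj : isSunEdge (sunColor false 0 8) ∧ isSunEdge (sunColor false 16 0) ∧
      isSunEdge (sunColor false 16 8) := by decide +kernel
  have hcount : 3 ≤ (sunNbrColors false 0 8).countP isSunEdge ∧
      3 ≤ (sunNbrColors false 16 0).countP isSunEdge ∧
      3 ≤ (sunNbrColors false 16 8).countP isSunEdge := by decide +kernel
  have hcard : ∀ i j : Fin 30, _ := sunGraph_card_commonNbrs (a := a) (t := false)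
  exact ⟨(0 : Fin 30), (8 : Fin 30), (16 : Fin 30), hadj,
    hcount.1.trans_eq (hcard 0 8).symm,
    hcount.2.1.trans_eq (hcard 16 0).symm,
    hcount.2.2.trans_eq (hcard 16 8).symm⟩

theorem not_hasHeavyTriangle_sunGraph (a : C) : ¬ HasHeavyTriangle (sunGraph a true) := by
  rintro ⟨u, v, w, ⟨huv, hwu, hwv⟩, h₁, h₂, h₃⟩
  rw [sunGraph_card_commonNbrs] at h₁ h₂ h₃
  have key : ∀ i j : (sunGraph a true).V, (sunGraph a true).graph.Adj i j →
      3 ≤ (sunNbrColors true (sunNode i) (sunNode j)).countP isSunEdge →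
      isSunHeavyEdge (sunColor true (sunNode i) (sunNode j)) :=
    fun i j => sunNbrColors_countP true _ (sunNode_lt i) _ (sunNode_lt j)
  exact sunColor_no_triangle _ (sunNode_lt u) _ (sunNode_lt v) (key u v huv h₁) _ (sunNode_lt w)
    ⟨key w u hwu h₂, key w v hwv h₃⟩

end SunGraph

theorem mainTheorem8 {C : Type} [Nonempty C] :
    (∀ (G H : ColoredGraph C) (l : ℕ) (v : Fin 2 → G.V) (v' : Fin 2 → H.V),
      ktColor (instES C) G l v = ktColor (instES C) H l v' ↔
        slColor G l (v 0) (v 1) = slColor H l (v' 0) (v' 1)) ∧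
    AsPowerful (ktFWLPlus (instES C)) (slfwl2 C) ∧
    ∀ a : SubgraphGNNArch, StrictlyMorePowerful (ktFWLPlus (instES C)) (a.test C) := by
  refine ⟨fun _ _ => ktColor_eq_iff_slColor_eq, ⟨fun G H => (ktFWLPlus_iff_slfwl2 G H).1,
    fun G H => (ktFWLPlus_iff_slfwl2 G H).2⟩, fun arch => ⟨fun G H h => ?_, ?_⟩⟩
  · exact (subgraphStable_stableColor ((ktFWLPlus_iff_slfwl2 G H).1 h)).test arch
  · obtain ⟨a⟩ := ‹Nonempty C›
    refine ⟨sunGraph a false, sunGraph a true, fun h => ?_,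
      (subgraphStable_sunGraph a false true).test arch⟩
    exact not_hasHeavyTriangle_sunGraph a
      ((hasHeavyTriangle_sunGraph a).of_slfwl2 ((ktFWLPlus_iff_slfwl2 _ _).1 h))
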